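/- For all real numbers $c_1,c_2,c_3>0$ there is a constant $C>0$, depending only on $c_1,c_2,c_3$, such that the following holds. Let $\nu:\mathbb N\to\mathbb C$ be a multiplicative function (that is, $\nu(1)=1$ and $\nu(mn)=\nu(m)\nu(n)$ whenever $\gcd(m,n)=1$), let $t\ge 1$ be an integer, and let $F:\mathbb N\to\mathbb C$ be periodic with period $t$. Assume that $|\nu(n)|\le 1$ and $|F(n)|\le 1$ for all $n\in\mathbb N$. Let $\rho<1$ be a real number such that for all primes $r\ne s$ and all positive integers $h\le t$ $$\left|\sum_{n\le h}F(nr)\overline{F(ns)}\right|\le c_1\max\{r,s\}\,t\rho .$$ Then for every real $\alpha>0$ with $$\alpha^{-2}\exp\left(2\alpha^{-1}(\log(1/\alpha))^6\right)\le c_2\,\rho^{-1}$$ and every integer $N$ with $$N\ge c_3\max\{1,t\rho\}\exp\left(4\alpha^{-1}(\log(1/\alpha))^6\right)$$ we have $$\left|\sum_{n\le N}\nu(n)F(n)\right|\le C\alpha N .$$ (The condition on $\alpha$ presupposes, and for $\rho\neq 0$ forces, $\rho>0$.) -/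

import Mathlib

/-! This is a quantitative Kátai–Bourgain–Sarnak–Ziegler argument. Put `L = log (1/α)` and `W = exp
(α⁻¹ L^6)`, let `P` be the primes in `(z, W]` with `z` a power of `1/α` up to constants in the
exponent, and cut `P` into blocks `p / k = i`, where `k` is about `α⁻⁶`. Almost every `n ≤ N`
factors uniquely as `n = m * p` with `p ∈ P` and `m` free of primes of `P` from the block of `p` and
from earlier blocks (`norm_sum_le_sum_blocks`). For such `n`, multiplicativity gives `ν n = ν m * ν
p`.

On one block, Cauchy–Schwarz in `m` removes `ν m`. Expanding the square leaves a diagonal, which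
saves `√k`, and correlations of `F (m * p)` with `F (m * q)`, which the hypothesis controls
(`norm_sum_block_sq_le`, `norm_block_le`). Summing over blocks costs `∑ 1/i ≤ 1 + log W`, far less
than `√k ≥ α⁻³`.

Two kinds of `n` are exceptional. Those divisible by two primes of one block, or by the square of
one, number at most `N * 2k/z` (`sum_same_block_le`). Those with no prime factor in `P` are counted
by an elementary sieve (`card_sifted_mul_log_le`), whose bound is `N` times `(log z)^4 / log W` up
to constants. The sixth power of `L` in `W` absorbs the fourth power, so a weak form of Mertens'
theorem suffices. -/

open Finset Classical in
theorem sum_le_sum_of_injOn {ι κ : Type*} {s : Finset ι} {t : Finset κ} {f : ι → ℝ} {g : κ → ℝ}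
    (e : ι → κ) (he : ∀ i ∈ s, e i ∈ t) (hinj : Set.InjOn e s)
    (hfg : ∀ i ∈ s, f i ≤ g (e i)) (hg : ∀ j ∈ t, 0 ≤ g j) :
    ∑ i ∈ s, f i ≤ ∑ j ∈ t, g j := by
  refine (sum_le_sum hfg).trans ?_
  rw [← sum_image hinj]
  exact sum_le_sum_of_subset_of_nonneg (image_subset_iff.2 he) fun j hj _ => hg j hj

/-! ### Reciprocal sums over smooth numbers and a weak Mertens bound -/

open Finset Classical in
theorem sum_inv_smooth_le (z n : ℕ) :
    ∑ b ∈ Icc 1 n with ∀ p : ℕ, p.Prime → p ∣ b → p ≤ z, (b : ℝ)⁻¹ ≤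
      ∏ p ∈ (z + 1).primesBelow, (1 - (p : ℝ)⁻¹)⁻¹ := by
  let f : ℕ →* ℝ :=
    { toFun := fun n => (n : ℝ)⁻¹
      map_one' := by simp
      map_mul' := fun a b => by push_cast; rw [mul_inv] }
  have hf : ∀ {p : ℕ}, p.Prime → ‖f p‖ < 1 := by
    intro p hp
    change ‖(p : ℝ)⁻¹‖ < 1
    rw [Real.norm_of_nonneg (by positivity)]
    exact inv_lt_one_of_one_lt₀ (by exact_mod_cast hp.one_lt)
  have h := (EulerProduct.summable_and_hasSum_smoothNumbers_prod_primesBelow_geometric hf (z + 1)).2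
  have h2 := (hasSum_subtype_iff_indicator (f := fun m => f m)).1 h
  have h3 := sum_le_hasSum ({b ∈ Icc 1 n | ∀ p : ℕ, p.Prime → p ∣ b → p ≤ z}) (fun i _ => by
    apply Set.indicator_nonneg
    intro x _
    change 0 ≤ (x : ℝ)⁻¹
    positivity) h2
  refine le_trans (le_of_eq ?_) h3
  apply sum_congr rfl
  intro b hb
  rw [mem_filter, mem_Icc] at hb
  rw [Set.indicator_of_mem]
  · rfl
  · rw [Nat.mem_smoothNumbers']
    intro p hp hpb
    exact Nat.lt_succ_of_le (hb.2 p hp hpb)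

-- On a dyadic interval `log p ≥ j log 2` and `p - 1 ≥ 2 ^ j`, so Chebyshev's bound on `θ (2 ^ (j +
-- 1))` is enough.
open Finset Classical in
theorem sum_primes_dyadic_le (j : ℕ) (hj : 1 ≤ j) :
    ∑ p ∈ Ioc (2 ^ j : ℕ) (2 ^ (j + 1)) with p.Prime, ((p : ℝ) - 1)⁻¹ ≤ 4 / (j : ℝ) := by
  have hl2 : 0 < Real.log 2 := Real.log_pos (by norm_num)
  have hj' : (0 : ℝ) < j := by exact_mod_cast hj
  have h1 : ∀ p ∈ {p ∈ Ioc (2 ^ j : ℕ) (2 ^ (j + 1)) | p.Prime},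
      ((p : ℝ) - 1)⁻¹ ≤ Real.log p * ((2 : ℝ) ^ j * (j * Real.log 2))⁻¹ := by
    intro p hp
    rw [mem_filter, mem_Ioc] at hp
    have h2 : (2 : ℝ) ^ j ≤ (p : ℝ) - 1 := by
      have : ((2 ^ j + 1 : ℕ) : ℝ) ≤ p := by exact_mod_cast hp.1.1
      push_cast at this
      linarith
    have h3 : (j : ℝ) * Real.log 2 ≤ Real.log p := by
      rw [← Real.log_pow]
      apply Real.log_le_log (by positivity)
      linarith
    have h4 : ((p : ℝ) - 1)⁻¹ ≤ ((2 : ℝ) ^ j)⁻¹ := inv_anti₀ (by positivity) h2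
    refine h4.trans ?_
    rw [mul_inv, mul_comm, mul_assoc]
    refine le_mul_of_one_le_right (by positivity) ?_
    rw [inv_mul_eq_div, one_le_div (by positivity)]
    exact h3
  refine (sum_le_sum h1).trans ?_
  rw [← sum_mul]
  have h5 : ∑ p ∈ Ioc (2 ^ j : ℕ) (2 ^ (j + 1)) with p.Prime, Real.log p ≤
      Real.log 4 * (2 : ℝ) ^ (j + 1) := by
    refine le_trans ?_ (Chebyshev.theta_le_log4_mul_x (x := (2 : ℝ) ^ (j + 1)) (by positivity))
    rw [Chebyshev.theta]
    apply sum_le_sum_of_subset_of_nonneg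
    · intro p hp
      rw [mem_filter, mem_Ioc] at hp ⊢
      refine ⟨⟨hp.2.pos, Nat.le_floor ?_⟩, hp.2⟩
      exact_mod_cast hp.1.2
    · intro p _ _
      exact Real.log_natCast_nonneg p
  have h6 : Real.log 4 = 2 * Real.log 2 := by
    rw [show (4 : ℝ) = 2 ^ 2 by norm_num, Real.log_pow]; norm_num
  refine (mul_le_mul_of_nonneg_right h5 (by positivity)).trans (le_of_eq ?_)
  rw [h6]
  field_simp
  ring

open Finset Classical in
theorem sum_primesBelow_inv_le (J : ℕ) :
    ∑ p ∈ (2 ^ (J + 1) + 1 : ℕ).primesBelow, ((p : ℝ) - 1)⁻¹ ≤ 1 + 4 * (harmonic J : ℝ) := by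
  induction J with
  | zero =>
    have : (2 ^ (0 + 1) + 1 : ℕ).primesBelow = {2} := by decide
    rw [this]
    norm_num
  | succ J ih =>
    have h : (2 ^ (J + 1 + 1) + 1 : ℕ).primesBelow ⊆
        (2 ^ (J + 1) + 1 : ℕ).primesBelow ∪ {p ∈ Ioc (2 ^ (J + 1) : ℕ) (2 ^ (J + 1 + 1)) | p.Prime} := by
      intro p hp
      rw [Nat.mem_primesBelow] at hp
      rw [mem_union, Nat.mem_primesBelow, mem_filter, mem_Ioc]
      by_cases hlt : p < 2 ^ (J + 1) + 1
      · exact Or.inl ⟨hlt, hp.2⟩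
      · exact Or.inr ⟨⟨by omega, by omega⟩, hp.2⟩
    have hnn : ∀ p : ℕ, p.Prime → (0 : ℝ) ≤ ((p : ℝ) - 1)⁻¹ := by
      intro p hp
      have : (1 : ℝ) ≤ p := by exact_mod_cast hp.one_le
      exact inv_nonneg.2 (by linarith)
    have h2 := sum_primes_dyadic_le (J + 1) (by omega)
    have h3 : ∑ p ∈ (2 ^ (J + 1 + 1) + 1 : ℕ).primesBelow, ((p : ℝ) - 1)⁻¹ ≤
        ∑ p ∈ (2 ^ (J + 1) + 1 : ℕ).primesBelow, ((p : ℝ) - 1)⁻¹ +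
        ∑ p ∈ Ioc (2 ^ (J + 1) : ℕ) (2 ^ (J + 1 + 1)) with p.Prime, ((p : ℝ) - 1)⁻¹ := by
      rw [← sum_union]
      · apply sum_le_sum_of_subset_of_nonneg h
        intro p hp _
        rw [mem_union, Nat.mem_primesBelow, mem_filter] at hp
        exact hnn p (hp.elim (·.2) (·.2))
      · rw [disjoint_left]
        intro p hp hp'
        rw [Nat.mem_primesBelow] at hp
        rw [mem_filter, mem_Ioc] at hp'
        omega
    rw [harmonic_succ]
    push_cast at h2 ⊢
    have : 4 / ((J : ℝ) + 1) = 4 * ((J : ℝ) + 1)⁻¹ := div_eq_mul_inv _ _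
    linarith

-- Each Euler factor is `1 + 1/(p - 1) ≤ exp (1/(p - 1))`, and the exponents sum to at most `1 + 4
-- (1 + log J)`. The true order is `J`; the loss to `J ^ 4` is harmless later.
open Finset Classical in
theorem prod_primesBelow_le (J : ℕ) (hJ : 1 ≤ J) :
    ∏ p ∈ (2 ^ (J + 1) + 1 : ℕ).primesBelow, (1 - (p : ℝ)⁻¹)⁻¹ ≤ Real.exp 5 * (J : ℝ) ^ 4 := by
  have h1 : ∏ p ∈ (2 ^ (J + 1) + 1 : ℕ).primesBelow, (1 - (p : ℝ)⁻¹)⁻¹ ≤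
      ∏ p ∈ (2 ^ (J + 1) + 1 : ℕ).primesBelow, Real.exp (((p : ℝ) - 1)⁻¹) := by
    apply prod_le_prod
    · intro p hp
      have hp1 : (1 : ℝ) < p := by exact_mod_cast (Nat.mem_primesBelow.1 hp).2.one_lt
      have : (p : ℝ)⁻¹ < 1 := inv_lt_one_of_one_lt₀ hp1
      exact inv_nonneg.2 (by linarith)
    · intro p hp
      have hp1 : (1 : ℝ) < p := by exact_mod_cast (Nat.mem_primesBelow.1 hp).2.one_lt
      have h := Real.add_one_le_exp (((p : ℝ) - 1)⁻¹)
      refine le_trans (le_of_eq ?_) h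
      have h2 : (p : ℝ) - 1 ≠ 0 := by linarith
      field_simp
      ring
  refine h1.trans ?_
  rw [← Real.exp_sum]
  have hJ0 : (0 : ℝ) < J := by exact_mod_cast hJ
  have h3 := sum_primesBelow_inv_le J
  have h4 := harmonic_le_one_add_log J
  calc _ ≤ Real.exp (5 + 4 * Real.log J) := Real.exp_le_exp.2 (by linarith)
    _ = _ := by
      rw [Real.exp_add, mul_comm (4 : ℝ), Real.exp_mul, Real.exp_log hJ0]
      norm_cast

/-! ### Counting integers without prime factors in an interval -/

theorem exists_smooth_mul_rough (z n : ℕ) (hn : n ≠ 0) :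
    ∃ b a : ℕ, n = b * a ∧ (∀ p : ℕ, p.Prime → p ∣ b → p ≤ z) ∧
      (∀ p : ℕ, p.Prime → p ∣ a → z < p) := by
  induction n using Nat.recOnMul with
  | zero => exact absurd rfl hn
  | one => exact ⟨1, 1, rfl, fun p hp h => absurd (Nat.dvd_one.1 h) hp.ne_one,
      fun p hp h => absurd (Nat.dvd_one.1 h) hp.ne_one⟩
  | prime q hq =>
    by_cases h : q ≤ z
    · exact ⟨q, 1, by simp, fun p hp hd => ((Nat.prime_dvd_prime_iff_eq hp hq).1 hd) ▸ h,
        fun p hp h => absurd (Nat.dvd_one.1 h) hp.ne_one⟩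
    · exact ⟨1, q, by simp, fun p hp h => absurd (Nat.dvd_one.1 h) hp.ne_one,
        fun p hp hd => ((Nat.prime_dvd_prime_iff_eq hp hq).1 hd) ▸ (not_le.1 h)⟩
  | mul x y hx hy =>
    obtain ⟨b, a, rfl, hb, ha⟩ := hx (left_ne_zero_of_mul hn)
    obtain ⟨b', a', rfl, hb', ha'⟩ := hy (right_ne_zero_of_mul hn)
    exact ⟨b * b', a * a', by ring,
      fun p hp h => ((hp.dvd_mul).1 h).elim (hb p hp) (hb' p hp),
      fun p hp h => ((hp.dvd_mul).1 h).elim (ha p hp) (ha' p hp)⟩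

open Finset Classical in
theorem harmonic_le_smooth_mul_rough (z w : ℕ) :
    (harmonic w : ℝ) ≤
      (∑ b ∈ Icc 1 w with ∀ p : ℕ, p.Prime → p ∣ b → p ≤ z, (b : ℝ)⁻¹) *
      ∑ a ∈ Icc 1 w with ∀ p : ℕ, p.Prime → p ∣ a → z < p, (a : ℝ)⁻¹ := by
  rw [harmonic_eq_sum_Icc, sum_mul_sum, ← sum_product']
  push_cast
  refine le_trans (sum_le_sum_of_subset_of_nonneg
    (t := (({b ∈ Icc 1 w | ∀ p : ℕ, p.Prime → p ∣ b → p ≤ z}) ×ˢ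
      ({a ∈ Icc 1 w | ∀ p : ℕ, p.Prime → p ∣ a → z < p})).image (fun x => x.1 * x.2)) ?_ ?_) ?_
  · intro n hn
    rw [mem_Icc] at hn
    obtain ⟨b, a, rfl, hb, ha⟩ := exists_smooth_mul_rough z n (by omega)
    have hb0 : 0 < b := Nat.pos_of_ne_zero (by rintro rfl; simp at hn)
    have ha0 : 0 < a := Nat.pos_of_ne_zero (by rintro rfl; simp at hn)
    rw [mem_image]
    refine ⟨(b, a), ?_, rfl⟩
    rw [mem_product, mem_filter, mem_filter, mem_Icc, mem_Icc]
    exact ⟨⟨⟨hb0, (Nat.le_mul_of_pos_right b ha0).trans hn.2⟩, hb⟩,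
      ⟨⟨ha0, (Nat.le_mul_of_pos_left a hb0).trans hn.2⟩, ha⟩⟩
  · intros; positivity
  · refine (sum_image_le_of_nonneg (fun i _ => ?_)).trans (le_of_eq ?_)
    · positivity
    · apply sum_congr rfl
      intro x _
      push_cast
      rw [mul_inv]

-- A sifted `c` and a rough `a ≤ w` are always coprime, since the primes of `a` lie in `(z, w]`.
-- Hence `c * a` determines both factors, and the products are distinct integers up to `N * w`. With
-- the lower bound for the rough sum from `harmonic_le_smooth_mul_rough`, this bounds the sifted
-- sum.
open Finset Classical in
theorem sum_inv_mul_sum_inv_le_harmonic (z w N : ℕ) :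
    (∑ c ∈ Icc 1 N with ∀ p : ℕ, p.Prime → z < p → p ≤ w → ¬ p ∣ c, (c : ℝ)⁻¹) *
      (∑ a ∈ Icc 1 w with ∀ p : ℕ, p.Prime → p ∣ a → z < p, (a : ℝ)⁻¹) ≤
      (harmonic (N * w) : ℝ) := by
  rw [harmonic_eq_sum_Icc, sum_mul_sum, ← sum_product']
  push_cast
  set S := {c ∈ Icc 1 N | ∀ p : ℕ, p.Prime → z < p → p ≤ w → ¬ p ∣ c} with hS
  set A := {a ∈ Icc 1 w | ∀ p : ℕ, p.Prime → p ∣ a → z < p} with hA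
  have hcop : ∀ c ∈ S, ∀ a ∈ A, Nat.Coprime c a := by
    intro c hc a ha
    rw [hS, mem_filter, mem_Icc] at hc
    rw [hA, mem_filter, mem_Icc] at ha
    refine Nat.Coprime.symm (Nat.coprime_of_dvd fun p hp hpa hpc => ?_)
    exact hc.2 p hp (ha.2 p hp hpa) ((Nat.le_of_dvd (by omega) hpa).trans ha.1.2) hpc
  have hinj : Set.InjOn (fun x : ℕ × ℕ => x.1 * x.2) (S ×ˢ A : Finset (ℕ × ℕ)) := by
    rintro ⟨c, a⟩ h1 ⟨c', a'⟩ h2 h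
    rw [mem_coe, mem_product] at h1 h2
    simp only at h h1 h2
    have e1 : c ∣ c' := (hcop c h1.1 a' h2.2).dvd_of_dvd_mul_right (h ▸ Dvd.intro _ rfl)
    have e2 : c' ∣ c := (hcop c' h2.1 a h1.2).dvd_of_dvd_mul_right (h ▸ Dvd.intro _ rfl)
    have e := Nat.dvd_antisymm e1 e2
    subst e
    have hc0 : 0 < c := by
      have := h1.1
      rw [hS, mem_filter, mem_Icc] at this
      omega
    rw [Nat.eq_of_mul_eq_mul_left hc0 h]
  calc ∑ x ∈ S ×ˢ A, (x.1 : ℝ)⁻¹ * (x.2 : ℝ)⁻¹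
      = ∑ x ∈ S ×ˢ A, ((x.1 * x.2 : ℕ) : ℝ)⁻¹ := by
        apply sum_congr rfl
        intro x _
        push_cast
        rw [mul_inv]
    _ = ∑ n ∈ (S ×ˢ A).image (fun x : ℕ × ℕ => x.1 * x.2), ((n : ℕ) : ℝ)⁻¹ := by
        rw [sum_image hinj]
    _ ≤ _ := by
        apply sum_le_sum_of_subset_of_nonneg
        · intro n hn
          rw [mem_image] at hn
          obtain ⟨⟨c, a⟩, hx, rfl⟩ := hn
          rw [mem_product, hS, hA, mem_filter, mem_filter, mem_Icc, mem_Icc] at hx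
          rw [mem_Icc]
          exact ⟨Nat.mul_pos hx.1.1.1 hx.2.1.1, Nat.mul_le_mul hx.1.1.2 hx.2.1.2⟩
        · intros; positivity

theorem natCast_mul_log_sub_log_factorial_le (N : ℕ) :
    (N : ℝ) * Real.log N - Real.log (N.factorial) ≤ N := by
  rcases Nat.eq_zero_or_pos N with rfl | hN
  · simp
  have hN' : (0 : ℝ) < N := by exact_mod_cast hN
  have hf : (0 : ℝ) < N.factorial := by exact_mod_cast Nat.factorial_pos N
  have h := Real.pow_div_factorial_le_exp (x := (N : ℝ)) hN'.le N
  have h2 := Real.log_le_log (by positivity) h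
  rw [Real.log_exp, Real.log_div (by positivity) hf.ne', Real.log_pow] at h2
  exact h2

-- Passes from a reciprocal sum to a count, with a gain of `log N`. Write `log N = log (N/n) + log
-- n`. The first part is at most `N` even over all `n`. In the second, expand `log n = ∑ Λ (n/m)`
-- over `m ∣ n`: closure under divisors keeps `m` in the set, the condition on `n/m` is dropped, and
-- Chebyshev bounds `ψ (N/m)`.
open Finset Classical in
theorem card_mul_log_le (S : ℕ → Prop) [DecidablePred S]
    (hS : ∀ m n : ℕ, S n → m ∣ n → S m) (N : ℕ) :
    (#{n ∈ Icc 1 N | S n} : ℝ) * Real.log N ≤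
      N + (Real.log 4 + 4) * N * ∑ n ∈ Icc 1 N with S n, (n : ℝ)⁻¹ := by
  have hA : ∑ n ∈ Icc 1 N with S n, (Real.log N - Real.log n) ≤ N := by
    calc ∑ n ∈ Icc 1 N with S n, (Real.log N - Real.log n)
        ≤ ∑ n ∈ Icc 1 N, (Real.log N - Real.log n) := by
          apply sum_le_sum_of_subset_of_nonneg (filter_subset _ _)
          intro n hn _
          rw [mem_Icc] at hn
          have : Real.log n ≤ Real.log N :=
            Real.log_le_log (by exact_mod_cast hn.1) (by exact_mod_cast hn.2)
          linarith
      _ = N * Real.log N - Real.log N.factorial := by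
          rw [sum_sub_distrib, sum_const, Nat.card_Icc, nsmul_eq_mul]
          congr 1
          clear hS
          induction N with
          | zero => simp
          | succ N ih =>
            rw [sum_Icc_succ_top (by omega), ih, Nat.factorial_succ, Nat.cast_mul,
              Real.log_mul (by positivity) (by positivity), add_comm]
      _ ≤ N := natCast_mul_log_sub_log_factorial_le N
  have hB : ∑ n ∈ Icc 1 N with S n, Real.log n ≤
      (Real.log 4 + 4) * N * ∑ n ∈ Icc 1 N with S n, (n : ℝ)⁻¹ := by
    calc ∑ n ∈ Icc 1 N with S n, Real.log n
        = ∑ n ∈ Icc 1 N with S n, ∑ m ∈ n.divisors, ArithmeticFunction.vonMangoldt (n / m) := by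
          apply sum_congr rfl
          intro n _
          rw [Nat.sum_div_divisors, ArithmeticFunction.vonMangoldt_sum]
      _ ≤ ∑ m ∈ Icc 1 N with S m, ∑ d ∈ Ioc 0 (N / m), ArithmeticFunction.vonMangoldt d := by
          rw [sum_sigma', sum_sigma']
          refine sum_le_sum_of_injOn (fun x => ⟨x.2, x.1 / x.2⟩) ?_ ?_ ?_ ?_
          · rintro ⟨n, m⟩ h
            simp only [mem_sigma, mem_filter, mem_Icc, Nat.mem_divisors] at h
            obtain ⟨⟨⟨hn1, hnN⟩, hSn⟩, hmn, -⟩ := h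
            have hm0 : 0 < m := Nat.pos_of_dvd_of_pos hmn hn1
            simp only [mem_sigma, mem_filter, mem_Icc, mem_Ioc]
            exact ⟨⟨⟨hm0, (Nat.le_of_dvd hn1 hmn).trans hnN⟩, hS m n hSn hmn⟩,
              Nat.div_pos (Nat.le_of_dvd hn1 hmn) hm0, Nat.div_le_div_right hnN⟩
          · rintro ⟨n, m⟩ h ⟨n', m'⟩ h' e
            simp only [coe_sigma, Set.mem_sigma_iff, mem_coe, Nat.mem_divisors] at h h'
            simp only [Sigma.mk.injEq, heq_eq_eq] at e
            obtain ⟨rfl, e2⟩ := e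
            rw [Sigma.mk.injEq]
            refine ⟨?_, heq_of_eq rfl⟩
            rw [← Nat.div_mul_cancel h.2.1, e2, Nat.div_mul_cancel h'.2.1]
          · intro x _
            exact le_rfl
          · intro x _
            exact ArithmeticFunction.vonMangoldt_nonneg
      _ ≤ ∑ m ∈ Icc 1 N with S m, (Real.log 4 + 4) * N * (m : ℝ)⁻¹ := by
          apply sum_le_sum
          intro m _
          have h := Chebyshev.psi_le_const_mul_self (x := (N : ℝ) / m) (by positivity)
          rw [Chebyshev.psi, Nat.floor_div_natCast, Nat.floor_natCast] at h
          refine h.trans (le_of_eq ?_)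
          ring
      _ = _ := by rw [mul_sum]
  rw [sum_sub_distrib, sum_const, nsmul_eq_mul] at hA
  linarith

/-! ### Cauchy–Schwarz on a block of primes -/

open Finset in
theorem norm_sum_periodic_le {g : ℕ → ℂ} {t : ℕ} (ht : 0 < t) (hg : Function.Periodic g t) {B : ℝ}
    (hB : 0 ≤ B) (h : ∀ r : ℕ, 0 < r → r ≤ t → ‖∑ n ∈ Icc 1 r, g n‖ ≤ B) (M : ℕ) :
    ‖∑ n ∈ Icc 1 M, g n‖ ≤ ((M : ℝ) / t + 1) * B := by
  have ht' : (0 : ℝ) < t := by exact_mod_cast ht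
  induction M using Nat.strong_induction_on with
  | _ M ih =>
    rcases Nat.eq_zero_or_pos M with rfl | hM
    · simpa using hB
    by_cases hMt : M ≤ t
    · refine (h M hM hMt).trans (le_mul_of_one_le_left hB ?_)
      have : (0 : ℝ) ≤ (M : ℝ) / t := by positivity
      linarith
    · obtain ⟨K, rfl⟩ : ∃ K, M = t + K := ⟨M - t, by omega⟩
      have e : ∑ n ∈ Icc 1 (t + K), g n = ∑ n ∈ Icc 1 t, g n + ∑ n ∈ Icc 1 K, g n := by
        clear ih hM hMt
        induction K with
        | zero => simp
        | succ K ihK =>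
          rw [← add_assoc, sum_Icc_succ_top (by omega), ihK, sum_Icc_succ_top (by omega), add_assoc]
          congr 2
          rw [← hg (K + 1)]
          congr 1
          ring
      rw [e]
      refine (norm_add_le _ _).trans ?_
      have h1 := h t ht le_rfl
      have h2 := ih K (by omega)
      push_cast
      have : ((t : ℝ) + K) / t = 1 + K / t := by field_simp
      rw [this]
      linarith

open Finset Classical in
theorem norm_sum_block_sq_le {I : Finset ℕ} {D N k : ℕ} (hD : 0 < D) (hI : ∀ p ∈ I, D ≤ p)
    (hk : #I ≤ k) {a b G : ℕ → ℂ} (ha : ∀ p ∈ I, ‖a p‖ ≤ 1) (hb : ∀ m, 0 < m → ‖b m‖ ≤ 1)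
    (hG : ∀ n, 0 < n → ‖G n‖ ≤ 1) {E : ℝ} (hE : 0 ≤ E)
    (hoff : ∀ p ∈ I, ∀ q ∈ I, p ≠ q → ∀ M ≤ N / D,
      ‖∑ m ∈ Icc 1 M, G (m * p) * (starRingEnd ℂ) (G (m * q))‖ ≤ E) :
    ‖∑ m ∈ Icc 1 (N / D), b m * ∑ p ∈ I with m * p ≤ N, a p * G (m * p)‖ ^ 2 ≤
      ((N / D : ℕ) : ℝ) * (k * ((N / D : ℕ) : ℝ) + k ^ 2 * E) := by
  set X := N / D with hX
  set T : ℕ → ℂ := fun m => ∑ p ∈ I with m * p ≤ N, a p * G (m * p) with hT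
  have h1 : ‖∑ m ∈ Icc 1 X, b m * T m‖ ≤ ∑ m ∈ Icc 1 X, ‖T m‖ := by
    refine (norm_sum_le _ _).trans (sum_le_sum fun m hm => ?_)
    rw [norm_mul]
    exact mul_le_of_le_one_left (norm_nonneg _) (hb m (mem_Icc.1 hm).1)
  have h2 : (∑ m ∈ Icc 1 X, ‖T m‖) ^ 2 ≤ X * ∑ m ∈ Icc 1 X, ‖T m‖ ^ 2 := by
    have := sq_sum_le_card_mul_sum_sq (s := Icc 1 X) (f := fun m => ‖T m‖)
    rwa [Nat.card_Icc, Nat.add_sub_cancel] at this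
  -- The two cutoffs merge into one, so each correlation runs over an initial interval of `m`, where
  -- the hypothesis `hoff` applies.
  have hcond : ∀ p ∈ I, ∀ q ∈ I, ({m ∈ Icc 1 X | m * p ≤ N ∧ m * q ≤ N}) =
      Icc 1 (N / max p q) ∧ N / max p q ≤ X := by
    intro p hp q hq
    have hp0 : 0 < p := hD.trans_le (hI p hp)
    have hle : N / max p q ≤ X := Nat.div_le_div_left ((hI p hp).trans (le_max_left _ _)) hD
    refine ⟨?_, hle⟩
    ext m
    have : m ≤ N / max p q ↔ m * p ≤ N ∧ m * q ≤ N := by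
      rw [Nat.le_div_iff_mul_le (lt_max_of_lt_left hp0)]
      rcases le_total p q with h | h
      · rw [max_eq_right h]
        exact ⟨fun hm => ⟨(Nat.mul_le_mul_left m h).trans hm, hm⟩, fun hm => hm.2⟩
      · rw [max_eq_left h]
        exact ⟨fun hm => ⟨hm, (Nat.mul_le_mul_left m h).trans hm⟩, fun hm => hm.1⟩
    rw [mem_filter, mem_Icc, mem_Icc, ← this]
    exact ⟨fun h => ⟨h.1.1, h.2⟩, fun h => ⟨⟨h.1, h.2.trans hle⟩, h.2⟩⟩
  have h3 : ((∑ m ∈ Icc 1 X, ‖T m‖ ^ 2 : ℝ) : ℂ) =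
      ∑ p ∈ I, ∑ q ∈ I, a p * (starRingEnd ℂ) (a q) *
        ∑ m ∈ Icc 1 (N / max p q), G (m * p) * (starRingEnd ℂ) (G (m * q)) := by
    calc ((∑ m ∈ Icc 1 X, ‖T m‖ ^ 2 : ℝ) : ℂ) = ∑ m ∈ Icc 1 X, T m * (starRingEnd ℂ) (T m) := by
          push_cast
          exact sum_congr rfl fun m _ => (Complex.mul_conj' _).symm
      _ = ∑ m ∈ Icc 1 X, ∑ p ∈ I, ∑ q ∈ I, if m * p ≤ N ∧ m * q ≤ N then
            a p * (starRingEnd ℂ) (a q) * (G (m * p) * (starRingEnd ℂ) (G (m * q))) else 0 := by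
          apply sum_congr rfl
          intro m _
          rw [hT]
          simp only [map_sum, map_mul]
          rw [sum_mul_sum, sum_filter]
          apply sum_congr rfl
          intro p _
          by_cases hp : m * p ≤ N
          · simp only [hp, if_true, true_and]
            rw [sum_filter]
            apply sum_congr rfl
            intro q _
            split_ifs <;> ring
          · simp [hp]
      _ = ∑ p ∈ I, ∑ q ∈ I, ∑ m ∈ Icc 1 X, if m * p ≤ N ∧ m * q ≤ N then
            a p * (starRingEnd ℂ) (a q) * (G (m * p) * (starRingEnd ℂ) (G (m * q))) else 0 := by
          rw [sum_comm]
          exact sum_congr rfl fun p _ => sum_comm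
      _ = _ := by
          apply sum_congr rfl
          intro p hp
          apply sum_congr rfl
          intro q hq
          rw [← sum_filter, (hcond p hp q hq).1, mul_sum]
  have hterm : ∀ p ∈ I, ∀ q ∈ I, ‖a p * (starRingEnd ℂ) (a q) *
        ∑ m ∈ Icc 1 (N / max p q), G (m * p) * (starRingEnd ℂ) (G (m * q))‖ ≤
        (if p = q then (X : ℝ) else 0) + E := by
    intro p hp q hq
    rw [norm_mul]
    have hle : ‖a p * (starRingEnd ℂ) (a q)‖ ≤ 1 := by
      rw [norm_mul, RCLike.norm_conj]
      exact mul_le_one₀ (ha p hp) (norm_nonneg _) (ha q hq)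
    refine (mul_le_of_le_one_left (norm_nonneg _) hle).trans ?_
    split_ifs with hpq
    · subst hpq
      refine le_trans ?_ (le_add_of_nonneg_right hE)
      refine (norm_sum_le_of_le (n := fun _ => (1 : ℝ)) _ fun m hm => ?_).trans ?_
      · have hp0 : 0 < p := hD.trans_le (hI p hp)
        have := hG (m * p) (Nat.mul_pos (mem_Icc.1 hm).1 hp0)
        rw [norm_mul, RCLike.norm_conj]
        exact mul_le_one₀ this (norm_nonneg _) this
      · simp only [sum_const, Nat.card_Icc, Nat.add_sub_cancel, nsmul_eq_mul, mul_one]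
        exact_mod_cast (hcond p hp p hp).2
    · rw [zero_add]
      exact hoff p hp q hq hpq _ (hcond p hp q hq).2
  have h4 : ∑ m ∈ Icc 1 X, ‖T m‖ ^ 2 ≤ k * X + k ^ 2 * E := by
    have h5 : ∑ m ∈ Icc 1 X, ‖T m‖ ^ 2 = ‖((∑ m ∈ Icc 1 X, ‖T m‖ ^ 2 : ℝ) : ℂ)‖ := by
      rw [Complex.norm_real, Real.norm_of_nonneg]
      exact sum_nonneg fun _ _ => by positivity
    rw [h5, h3]
    have hk' : (#I : ℝ) ≤ k := by exact_mod_cast hk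
    calc _ ≤ ∑ p ∈ I, ∑ q ∈ I, ((if p = q then (X : ℝ) else 0) + E) :=
          norm_sum_le_of_le _ fun p hp => norm_sum_le_of_le _ fun q hq => hterm p hp q hq
      _ = #I * X + (#I : ℝ) ^ 2 * E := by
          simp only [sum_add_distrib, sum_ite_eq, sum_const, nsmul_eq_mul]
          rw [sum_ite_mem, inter_self, sum_const, nsmul_eq_mul]
          ring
      _ ≤ k * X + k ^ 2 * E := by gcongr
  calc _ ≤ (∑ m ∈ Icc 1 X, ‖T m‖) ^ 2 := by gcongr
    _ ≤ X * ∑ m ∈ Icc 1 X, ‖T m‖ ^ 2 := h2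
    _ ≤ _ := by gcongr

/-! ### Decomposition of integers by a prime factor from a block -/

open Finset Classical in
theorem card_filter_dvd_le (N d : ℕ) :
    (#{n ∈ Icc 1 N | d ∣ n} : ℝ) ≤ (N : ℝ) / d := by
  have h : #{n ∈ Icc 1 N | d ∣ n} = N / d := by
    rw [← Nat.Ioc_filter_dvd_card_eq_div]
    rfl
  rw [h]
  exact Nat.cast_div_le

-- The condition on the cofactor `m` involves only the block index `i`, not `p` itself. Hence the
-- coefficient of `m` is the same for all primes of a block, as Cauchy–Schwarz requires. The price
-- is the last term, for `n` with two prime factors in one block; it includes `q = p`, that is, `p ^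
-- 2 ∣ n`.
open Finset Classical in
theorem norm_sum_le_sum_blocks {ν : ArithmeticFunction ℂ} (hν : ν.IsMultiplicative) {F : ℕ → ℂ}
    (hν1 : ∀ n : ℕ, 0 < n → ‖ν n‖ ≤ 1) (hF1 : ∀ n : ℕ, 0 < n → ‖F n‖ ≤ 1)
    {P : Finset ℕ} {k : ℕ} (hP : ∀ p ∈ P, p.Prime) (hk : 0 < k) (hPk : ∀ p ∈ P, k ≤ p) (N : ℕ) :
    ‖∑ n ∈ Icc 1 N, ν n * F n‖ ≤
      ∑ i ∈ P.image (· / k), ‖∑ m ∈ Icc 1 (N / (i * k)),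
        (if ∀ q ∈ P, q / k ≤ i → ¬ q ∣ m then ν m else 0) *
          ∑ p ∈ {p ∈ P | p / k = i} with m * p ≤ N, ν p * F (m * p)‖ +
      #{n ∈ Icc 1 N | ∀ p ∈ P, ¬ p ∣ n} +
      ∑ p ∈ P, ∑ q ∈ P with q / k = p / k, (N : ℝ) / (p * q : ℕ) := by
  set T : Finset (ℕ × ℕ) := {x ∈ P ×ˢ Icc 1 N | x.2 * x.1 ≤ N ∧
    ∀ q ∈ P, q / k ≤ x.1 / k → ¬ q ∣ x.2} with hT
  set S := {n ∈ Icc 1 N | ∀ p ∈ P, ¬ p ∣ n} with hS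
  set V := {n ∈ Icc 1 N | ∃ p ∈ P, ∃ q ∈ P, q / k = p / k ∧ p * q ∣ n} with hV
  set U := T.image (fun x => x.2 * x.1) with hU
  have hinj : Set.InjOn (fun x : ℕ × ℕ => x.2 * x.1) T := by
    have key : ∀ p m p' m', (p, m) ∈ T → (p', m') ∈ T → m * p = m' * p' → p / k ≤ p' / k →
        p = p' := by
      intro p m p' m' h h' e hle
      rw [hT, mem_filter, mem_product] at h h'
      by_contra hne
      have hd : p ∣ m' * p' := e ▸ Dvd.intro_left m rfl
      rcases (hP p h.1.1).dvd_mul.1 hd with hd | hd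
      · exact h'.2.2 p h.1.1 hle hd
      · exact hne ((Nat.prime_dvd_prime_iff_eq (hP p h.1.1) (hP p' h'.1.1)).1 hd)
    rintro ⟨p, m⟩ h ⟨p', m'⟩ h' e
    rw [mem_coe] at h h'
    simp only at e
    have hpp : p = p' := by
      rcases le_total (p / k) (p' / k) with hle | hle
      · exact key p m p' m' h h' e hle
      · exact (key p' m' p m h' h e.symm hle).symm
    subst hpp
    have hp0 : 0 < p := by
      rw [hT, mem_filter, mem_product] at h
      exact (hP p h.1.1).pos
    rw [Nat.eq_of_mul_eq_mul_right hp0 e]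
  have hUsub : U ⊆ Icc 1 N := by
    rw [hU, image_subset_iff]
    rintro ⟨p, m⟩ h
    rw [hT, mem_filter, mem_product, mem_Icc] at h
    rw [mem_Icc]
    exact ⟨Nat.mul_pos h.1.2.1 (hP p h.1.1).pos, h.2.1⟩
  have hrest : Icc 1 N \ U ⊆ S ∪ V := by
    intro n hn
    rw [mem_sdiff] at hn
    obtain ⟨hnI, hnU⟩ := hn
    rw [mem_union, hS, hV, mem_filter, mem_filter]
    by_cases hnS : ∀ p ∈ P, ¬ p ∣ n
    · exact Or.inl ⟨hnI, hnS⟩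
    right
    refine ⟨hnI, ?_⟩
    push Not at hnS
    obtain ⟨p₀, hp₀, hp₀n⟩ := hnS
    -- Take a prime factor in the earliest block. A forbidden prime `q` dividing the cofactor must
    -- then lie in the same block, so `p * q ∣ n` and `n ∈ V`.
    obtain ⟨p, hp, hmin⟩ := exists_min_image {p ∈ P | p ∣ n} (· / k) ⟨p₀, mem_filter.2 ⟨hp₀, hp₀n⟩⟩
    rw [mem_filter] at hp
    obtain ⟨m, rfl⟩ := hp.2
    rw [mem_Icc] at hnI
    have hp0 := (hP p hp.1).pos
    have hm0 : 0 < m := Nat.pos_of_ne_zero (by rintro rfl; simp at hnI)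
    by_contra hcon
    push Not at hcon
    apply hnU
    rw [hU, mem_image]
    refine ⟨(p, m), ?_, mul_comm _ _⟩
    rw [hT, mem_filter, mem_product, mem_Icc]
    refine ⟨⟨hp.1, hm0, (Nat.le_mul_of_pos_left m hp0).trans hnI.2⟩,
      by rw [mul_comm]; exact hnI.2, ?_⟩
    intro q hq hle hqm
    have h1 := hmin q (mem_filter.2 ⟨hq, hqm.mul_left p⟩)
    exact hcon p hp.1 q hq (le_antisymm hle h1) (mul_dvd_mul_left p hqm)
  have hbd : ∀ n ∈ Icc 1 N, ‖ν n * F n‖ ≤ 1 := by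
    intro n hn
    rw [norm_mul]
    exact mul_le_one₀ (hν1 n (mem_Icc.1 hn).1) (norm_nonneg _) (hF1 n (mem_Icc.1 hn).1)
  have hsplit : ‖∑ n ∈ Icc 1 N, ν n * F n‖ ≤ ‖∑ n ∈ U, ν n * F n‖ + #S + #V := by
    rw [← sum_sdiff hUsub, add_comm]
    refine (norm_add_le _ _).trans ?_
    have h1 : ‖∑ n ∈ Icc 1 N \ U, ν n * F n‖ ≤ #(Icc 1 N \ U) := by
      refine (norm_sum_le_of_le (n := fun _ => (1 : ℝ)) _ fun n hn =>
        hbd n (mem_sdiff.1 hn).1).trans (le_of_eq (by simp))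
    have h2 : (#(Icc 1 N \ U) : ℝ) ≤ #S + #V := by
      exact_mod_cast (card_le_card hrest).trans (card_union_le _ _)
    linarith
  have hVle : (#V : ℝ) ≤ ∑ p ∈ P, ∑ q ∈ P with q / k = p / k, (N : ℝ) / (p * q : ℕ) := by
    have hsub : V ⊆ P.biUnion fun p => {q ∈ P | q / k = p / k}.biUnion fun q =>
        {n ∈ Icc 1 N | p * q ∣ n} := by
      intro n hn
      rw [hV, mem_filter] at hn
      obtain ⟨hnI, p, hp, q, hq, hpq, hd⟩ := hn
      simp only [mem_biUnion, mem_filter]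
      exact ⟨p, hp, q, ⟨hq, hpq⟩, hnI, hd⟩
    have h1 : #V ≤ ∑ p ∈ P, ∑ q ∈ P with q / k = p / k, #{n ∈ Icc 1 N | p * q ∣ n} :=
      (card_le_card hsub).trans (card_biUnion_le.trans (sum_le_sum fun p _ => card_biUnion_le))
    refine (Nat.cast_le.2 h1).trans ?_
    push_cast
    refine sum_le_sum fun p _ => sum_le_sum fun q _ => ?_
    have := card_filter_dvd_le N (p * q)
    exact_mod_cast this
  have hmain : ∑ n ∈ U, ν n * F n = ∑ i ∈ P.image (· / k), ∑ m ∈ Icc 1 (N / (i * k)),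
        (if ∀ q ∈ P, q / k ≤ i → ¬ q ∣ m then ν m else 0) *
          ∑ p ∈ {p ∈ P | p / k = i} with m * p ≤ N, ν p * F (m * p) := by
    rw [hU, sum_image hinj]
    calc ∑ x ∈ T, ν (x.2 * x.1) * F (x.2 * x.1)
        = ∑ x ∈ T, ν x.2 * (ν x.1 * F (x.2 * x.1)) := by
          apply sum_congr rfl
          rintro ⟨p, m⟩ h
          rw [hT, mem_filter, mem_product] at h
          have hcop : Nat.Coprime m p :=
            ((hP p h.1.1).coprime_iff_not_dvd.2 (h.2.2 p h.1.1 le_rfl)).symm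
          simp only
          rw [hν.map_mul_of_coprime hcop, mul_assoc]
      _ = ∑ i ∈ P.image (· / k), ∑ x ∈ T with x.1 / k = i, ν x.2 * (ν x.1 * F (x.2 * x.1)) := by
          rw [sum_fiberwise_of_maps_to]
          rintro ⟨p, m⟩ h
          rw [hT, mem_filter, mem_product] at h
          exact mem_image_of_mem _ h.1.1
      _ = _ := by
          apply sum_congr rfl
          intro i hi
          rw [mem_image] at hi
          obtain ⟨p₁, hp₁, rfl⟩ := hi
          have hik : 0 < p₁ / k * k := Nat.mul_pos (Nat.div_pos (hPk p₁ hp₁) hk) hk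
          simp only [mul_sum]
          rw [sum_sigma']
          refine sum_of_injOn (fun x => ⟨x.2, x.1⟩) ?_ ?_ ?_ ?_
          · rintro ⟨p, m⟩ _ ⟨p', m'⟩ _ e
            simp only [Sigma.mk.injEq, heq_eq_eq] at e
            rw [e.1, e.2]
          · rintro ⟨p, m⟩ h
            simp only [hT, coe_filter, mem_filter, mem_product, mem_Icc, Set.mem_ofPred_eq] at h
            obtain ⟨⟨⟨hp, hm⟩, hle, hq⟩, hi⟩ := h
            simp only [mem_coe, mem_sigma, mem_filter, mem_Icc]
            refine ⟨⟨hm.1, ?_⟩, ⟨hp, hi⟩, hle⟩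
            rw [Nat.le_div_iff_mul_le hik, ← hi]
            exact (Nat.mul_le_mul_left m (Nat.div_mul_le_self p k)).trans hle
          · rintro ⟨m, p⟩ h hnot
            simp only [mem_sigma, mem_filter, mem_Icc] at h
            obtain ⟨hm, ⟨hp, hi⟩, hle⟩ := h
            -- Pairs outside the image of `T` are exactly those whose cofactor has a forbidden
            -- prime, and their coefficient vanishes.
            rw [if_neg, zero_mul]
            intro hcond
            refine hnot ⟨(p, m), ?_, rfl⟩
            simp only [hT, coe_filter, mem_filter, mem_product, mem_Icc, Set.mem_ofPred_eq]
            exact ⟨⟨⟨hp, hm.1, (Nat.le_mul_of_pos_right m (hP p hp).pos).trans hle⟩, hle,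
              fun q hq hqk => hcond q hq (hi ▸ hqk)⟩, hi⟩
          · rintro ⟨p, m⟩ h
            simp only [hT, mem_filter, mem_product] at h
            rw [if_pos]
            exact fun q hq hqk => h.1.2.2 q hq (h.2 ▸ hqk)
  rw [hmain] at hsplit
  have := norm_sum_le (P.image (· / k)) fun i => ∑ m ∈ Icc 1 (N / (i * k)),
        (if ∀ q ∈ P, q / k ≤ i → ¬ q ∣ m then ν m else 0) *
          ∑ p ∈ {p ∈ P | p / k = i} with m * p ≤ N, ν p * F (m * p)
  linarith

open Finset Classical in
theorem sum_same_block_le {P : Finset ℕ} {k z w : ℕ} (hk : 0 < k) (hz : 2 * k ≤ z)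
    (hP : P ⊆ Ioc z w) :
    ∑ p ∈ P, ∑ q ∈ P with q / k = p / k, (1 : ℝ) / (p * q : ℕ) ≤ 2 * k / z := by
  have hz0 : 0 < z := by omega
  have h1 : ∀ p ∈ P, ∑ q ∈ P with q / k = p / k, (1 : ℝ) / (p * q : ℕ) ≤
      2 * k * ((p : ℝ) ^ 2)⁻¹ := by
    intro p hp
    have hpz := mem_Ioc.1 (hP hp)
    have hp0 : (0 : ℝ) < p := by exact_mod_cast (by omega : 0 < p)
    have hcard : #{q ∈ P | q / k = p / k} ≤ k := by
      have : {q ∈ P | q / k = p / k} ⊆ Ico (p / k * k) (p / k * k + k) := by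
        intro q hq
        rw [mem_filter] at hq
        rw [mem_Ico, ← hq.2]
        exact ⟨Nat.div_mul_le_self q k, Nat.lt_div_mul_add hk⟩
      simpa using card_le_card this
    have hq : ∀ q ∈ {q ∈ P | q / k = p / k}, (1 : ℝ) / (p * q : ℕ) ≤ 2 * ((p : ℝ) ^ 2)⁻¹ := by
      intro q hq
      rw [mem_filter] at hq
      have a1 : q / k * k ≤ q := Nat.div_mul_le_self q k
      have a2 : p < p / k * k + k := Nat.lt_div_mul_add hk
      rw [hq.2] at a1
      -- Primes of one block differ by less than `k`, while `p > z ≥ 2 * k`; so `q` may be replaced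
      -- by `p / 2`.
      have a3 : p ≤ 2 * q := by omega
      have a4 : (p : ℝ) ≤ 2 * q := by exact_mod_cast a3
      have a5 : (0 : ℝ) < q := by linarith
      push_cast
      rw [← div_eq_mul_inv, div_le_div_iff₀ (by positivity) (by positivity)]
      nlinarith
    refine (sum_le_card_nsmul _ _ _ hq).trans ?_
    rw [nsmul_eq_mul]
    have : (#{q ∈ P | q / k = p / k} : ℝ) ≤ k := by exact_mod_cast hcard
    calc _ ≤ (k : ℝ) * (2 * ((p : ℝ) ^ 2)⁻¹) := by gcongr
      _ = _ := by ring
  refine (sum_le_sum h1).trans ?_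
  rw [← mul_sum]
  have h2 : ∑ p ∈ P, ((p : ℝ) ^ 2)⁻¹ ≤ (z : ℝ)⁻¹ := by
    rcases le_total z w with hzw | hzw
    · refine (sum_le_sum_of_subset_of_nonneg hP fun _ _ _ => by positivity).trans ?_
      refine (sum_Ioc_inv_sq_le_sub hz0.ne' hzw).trans ?_
      have : (0 : ℝ) ≤ (w : ℝ)⁻¹ := by positivity
      linarith
    · have : P = ∅ := by rwa [Ioc_eq_empty (by omega), subset_empty] at hP
      subst this
      simp
  rw [div_eq_mul_inv]
  gcongr

/-! ### The sieve bound, one block, and all blocks together -/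

open Finset Classical in
theorem card_sifted_mul_log_le {J w N : ℕ} (hJ : 1 ≤ J) (hw : 1 ≤ w) (hwN : w ≤ N) :
    (#{n ∈ Icc 1 N | ∀ p ∈ {p ∈ Ioc (2 ^ (J + 1) : ℕ) w | p.Prime}, ¬ p ∣ n} : ℝ) * Real.log N ≤
      N + (Real.log 4 + 4) * N *
        (Real.exp 5 * (J : ℝ) ^ 4 * (1 + 2 * Real.log N) / harmonic w) := by
  set z : ℕ := 2 ^ (J + 1) with hz
  have hw' : (0 : ℝ) < w := by exact_mod_cast hw
  have hN' : (0 : ℝ) < N := by exact_mod_cast hw.trans hwN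
  have hset : {n ∈ Icc 1 N | ∀ p ∈ {p ∈ Ioc z w | p.Prime}, ¬ p ∣ n} =
      {n ∈ Icc 1 N | ∀ p : ℕ, p.Prime → z < p → p ≤ w → ¬ p ∣ n} := by
    apply filter_congr
    intro n _
    simp only [mem_filter, mem_Ioc]
    exact ⟨fun h p hp h1 h2 => h p ⟨⟨h1, h2⟩, hp⟩, fun h p hp => h p hp.2 hp.1.1 hp.1.2⟩
  rw [hset]
  refine (card_mul_log_le (fun n => ∀ p : ℕ, p.Prime → z < p → p ≤ w → ¬ p ∣ n)
    (fun m n h hmn p hp h1 h2 hd => h p hp h1 h2 (hd.trans hmn)) N).trans ?_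
  have hH : (0 : ℝ) < harmonic w := by
    exact_mod_cast harmonic_pos (by omega : w ≠ 0)
  have hl4 : 0 < Real.log 4 := Real.log_pos (by norm_num)
  have key : ∑ n ∈ Icc 1 N with ∀ p : ℕ, p.Prime → z < p → p ≤ w → ¬ p ∣ n, (n : ℝ)⁻¹ ≤
      Real.exp 5 * (J : ℝ) ^ 4 * (1 + 2 * Real.log N) / harmonic w := by
    rw [le_div_iff₀ hH]
    set S := ∑ n ∈ Icc 1 N with ∀ p : ℕ, p.Prime → z < p → p ≤ w → ¬ p ∣ n, (n : ℝ)⁻¹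
    have hS : 0 ≤ S := sum_nonneg fun _ _ => by positivity
    have h1 := harmonic_le_smooth_mul_rough z w
    have h2 := sum_inv_mul_sum_inv_le_harmonic z w N
    have h3 := (sum_inv_smooth_le z w).trans (prod_primesBelow_le J hJ)
    set A := ∑ a ∈ Icc 1 w with ∀ p : ℕ, p.Prime → p ∣ a → z < p, (a : ℝ)⁻¹
    have hA : 0 ≤ A := sum_nonneg fun _ _ => by positivity
    have h4 : (harmonic (N * w) : ℝ) ≤ 1 + 2 * Real.log N := by
      refine (harmonic_le_one_add_log _).trans ?_
      push_cast
      rw [Real.log_mul hN'.ne' hw'.ne']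
      have : Real.log w ≤ Real.log N := Real.log_le_log hw' (by exact_mod_cast hwN)
      linarith
    calc S * harmonic w ≤ S * ((Real.exp 5 * (J : ℝ) ^ 4) * A) := by
          gcongr
          exact h1.trans (by gcongr)
      _ = Real.exp 5 * (J : ℝ) ^ 4 * (S * A) := by ring
      _ ≤ _ := by
          gcongr
          exact h2.trans h4
  gcongr

-- The point is that the off-diagonal part does not exceed the diagonal by more than a constant, `k
-- * E ≤ C₁ * Y`. Splitting a range of length at most `Y` into periods costs `Y + t` in `E`: the `Y`
-- part is controlled by `W ^ 2 * ρ ≤ c₂`, the `t` part by the lower bound on `N`.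
open Finset Classical in
theorem norm_block_le {c₁ c₂ c₃ ρ W : ℝ} (hc₁ : 0 < c₁) (hc₂ : 0 < c₂) (hc₃ : 0 < c₃) (hρ : 0 < ρ)
    {F : ℕ → ℂ} {t : ℕ} (ht : 0 < t) (hF : Function.Periodic F t)
    (hF1 : ∀ n : ℕ, 0 < n → ‖F n‖ ≤ 1)
    (hcorr : ∀ r s h : ℕ, r.Prime → s.Prime → r ≠ s → 0 < h → h ≤ t →
      ‖∑ n ∈ Icc 1 h, F (n * r) * (starRingEnd ℂ) (F (n * s))‖
        ≤ c₁ * ((max r s : ℕ) : ℝ) * (t : ℝ) * ρ)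
    {P : Finset ℕ} {k N : ℕ} (hP : ∀ p ∈ P, p.Prime) (hk : 0 < k) (hPk : ∀ p ∈ P, k ≤ p)
    (hPW : ∀ p ∈ P, (p : ℝ) ≤ W) (hkW : (k : ℝ) ≤ W) (hW : 1 ≤ W) (hWρ : W ^ 2 * ρ ≤ c₂)
    (hN : c₃ * (t * ρ) * W ^ 4 ≤ N)
    {a b : ℕ → ℂ} (ha : ∀ n, 0 < n → ‖a n‖ ≤ 1) (hb : ∀ n, 0 < n → ‖b n‖ ≤ 1)
    {i : ℕ} (hi : i ∈ P.image (· / k)) :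
    ‖∑ m ∈ Icc 1 (N / (i * k)), b m *
        ∑ p ∈ {p ∈ P | p / k = i} with m * p ≤ N, a p * F (m * p)‖ ≤
      (N : ℝ) / i * ((1 + (c₁ * c₂ + c₁ / c₃)) / √k) := by
  set C₁ := c₁ * c₂ + c₁ / c₃ with hC₁
  have hC₁0 : 0 < C₁ := by positivity
  obtain ⟨p₁, hp₁, hp₁i⟩ := mem_image.1 hi
  change p₁ / k = i at hp₁i
  have hi0 : 0 < i := hp₁i ▸ Nat.div_pos (hPk p₁ hp₁) hk
  have hik : 0 < i * k := Nat.mul_pos hi0 hk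
  have hikp : ∀ p ∈ {p ∈ P | p / k = i}, i * k ≤ p := by
    intro p hp
    rw [← (mem_filter.1 hp).2]
    exact Nat.div_mul_le_self p k
  have hk' : (0 : ℝ) < k := by exact_mod_cast hk
  have hi' : (0 : ℝ) < i := by exact_mod_cast hi0
  have ht' : (0 : ℝ) < t := by exact_mod_cast ht
  set Y : ℝ := (N : ℝ) / (i * k : ℕ) with hY
  have hY0 : 0 ≤ Y := by positivity
  have hX : ((N / (i * k) : ℕ) : ℝ) ≤ Y := Nat.cast_div_le
  have hcard : #{p ∈ P | p / k = i} ≤ k := by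
    have : {p ∈ P | p / k = i} ⊆ Ico (i * k) (i * k + k) := by
      intro q hq
      rw [mem_filter] at hq
      rw [mem_Ico, ← hq.2]
      exact ⟨Nat.div_mul_le_self q k, Nat.lt_div_mul_add hk⟩
    simpa using card_le_card this
  set E : ℝ := c₁ * W * ρ * (Y + t) with hE
  have hE0 : 0 ≤ E := by positivity
  have hmain := norm_sum_block_sq_le (I := {p ∈ P | p / k = i}) (N := N) (a := a) (b := b) (G := F)
    hik hikp hcard (fun p hp => ha p (hP p (mem_filter.1 hp).1).pos) hb hF1 hE0 (by
      intro p hp q hq hpq M hM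
      rw [mem_filter] at hp hq
      have hper : Function.Periodic (fun m => F (m * p) * (starRingEnd ℂ) (F (m * q))) t := by
        intro m
        have e : ∀ s : ℕ, F ((m + t) * s) = F (m * s) := fun s => by
          rw [add_mul, mul_comm t s]
          exact hF.nat_mul s _
        simp only [e]
      have hmax : ((max p q : ℕ) : ℝ) ≤ W := by
        rw [Nat.cast_max]
        exact max_le (hPW p hp.1) (hPW q hq.1)
      have hB0 : 0 ≤ c₁ * ((max p q : ℕ) : ℝ) * (t : ℝ) * ρ := by positivity
      refine (norm_sum_periodic_le ht hper hB0 (fun r hr hrt =>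
        hcorr p q r (hP p hp.1) (hP q hq.1) hpq hr hrt) M).trans ?_
      have hMY : (M : ℝ) ≤ Y := (Nat.cast_le.2 hM).trans hX
      calc ((M : ℝ) / t + 1) * (c₁ * ((max p q : ℕ) : ℝ) * (t : ℝ) * ρ)
          = c₁ * ((max p q : ℕ) : ℝ) * ρ * (M + t) := by field_simp
        _ ≤ E := by rw [hE]; gcongr)
  have hkE : k * E ≤ C₁ * Y := by
    have h1 : (N : ℝ) ≤ W * Y := by
      have h2 : ((i * k : ℕ) : ℝ) ≤ W :=
        (Nat.cast_le.2 (hikp p₁ (mem_filter.2 ⟨hp₁, hp₁i⟩))).trans (hPW p₁ hp₁)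
      have h3 : ((i * k : ℕ) : ℝ) * Y = N := by
        rw [hY]
        field_simp
      rw [← h3]
      gcongr
    -- Since `i * k ≤ W`, passing from `N` to `Y` loses at most one factor `W`; the fourth power in
    -- `hN` leaves another to spare.
    have h4 : c₃ * (t * ρ) * W ^ 2 ≤ Y := by
      have h5 : W * (c₃ * (t * ρ) * W ^ 2) ≤ W * Y := by
        refine le_trans ?_ (hN.trans h1)
        have : W ^ 3 ≤ W ^ 4 := pow_le_pow_right₀ hW (by norm_num)
        calc W * (c₃ * (t * ρ) * W ^ 2) = c₃ * (t * ρ) * W ^ 3 := by ring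
          _ ≤ _ := by gcongr
      exact le_of_mul_le_mul_left h5 (by linarith)
    have h6 : c₁ * (W ^ 2 * ρ) * t ≤ c₁ / c₃ * Y := by
      calc c₁ * (W ^ 2 * ρ) * t = c₁ / c₃ * (c₃ * (t * ρ) * W ^ 2) := by field_simp
        _ ≤ _ := by gcongr
    have h7 : c₁ * (W ^ 2 * ρ) * Y ≤ c₁ * c₂ * Y := by gcongr
    calc k * E ≤ W * E := by gcongr
      _ = c₁ * (W ^ 2 * ρ) * Y + c₁ * (W ^ 2 * ρ) * t := by rw [hE]; ring
      _ ≤ C₁ * Y := by rw [hC₁, add_mul]; linarith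
  have hsq : (Y * (√k * (1 + C₁))) ^ 2 = Y * (k * Y * (1 + C₁) ^ 2) := by
    rw [mul_pow, mul_pow, Real.sq_sqrt hk'.le]
    ring
  have hfin : (N : ℝ) / i * ((1 + C₁) / √k) = Y * (√k * (1 + C₁)) := by
    have : (0 : ℝ) < √k := Real.sqrt_pos.2 hk'
    have h2 : (√k : ℝ) ^ 2 = k := Real.sq_sqrt hk'.le
    rw [hY]
    push_cast
    field_simp
    rw [h2]
  rw [hfin]
  refine (sq_le_sq₀ (norm_nonneg _) (by positivity)).1 ?_
  rw [hsq]
  refine hmain.trans ?_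
  -- The constant is enlarged to a square so that the root can be taken exactly.
  have h8 : k * ((N / (i * k) : ℕ) : ℝ) + k ^ 2 * E ≤ k * Y * (1 + C₁) ^ 2 := by
    calc k * ((N / (i * k) : ℕ) : ℝ) + k ^ 2 * E
        = k * ((N / (i * k) : ℕ) : ℝ) + k * (k * E) := by ring
      _ ≤ k * Y + k * (C₁ * Y) := by gcongr
      _ = k * Y * (1 + C₁) := by ring
      _ ≤ _ := by
        gcongr
        nlinarith
  gcongr

open Finset Classical in
theorem norm_sum_mul_le {c₁ c₂ c₃ ρ W : ℝ} (hc₁ : 0 < c₁) (hc₂ : 0 < c₂) (hc₃ : 0 < c₃) (hρ : 0 < ρ)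
    {ν : ArithmeticFunction ℂ} (hν : ν.IsMultiplicative)
    {F : ℕ → ℂ} {t : ℕ} (ht : 0 < t) (hF : Function.Periodic F t)
    (hν1 : ∀ n : ℕ, 0 < n → ‖ν n‖ ≤ 1) (hF1 : ∀ n : ℕ, 0 < n → ‖F n‖ ≤ 1)
    (hcorr : ∀ r s h : ℕ, r.Prime → s.Prime → r ≠ s → 0 < h → h ≤ t →
      ‖∑ n ∈ Icc 1 h, F (n * r) * (starRingEnd ℂ) (F (n * s))‖
        ≤ c₁ * ((max r s : ℕ) : ℝ) * (t : ℝ) * ρ)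
    {k z N : ℕ} (hk : 0 < k) (hz : 2 * k ≤ z) (hkW : (k : ℝ) ≤ W) (hW : 1 ≤ W)
    (hWρ : W ^ 2 * ρ ≤ c₂) (hN : c₃ * (t * ρ) * W ^ 4 ≤ N) :
    ‖∑ n ∈ Icc 1 N, ν n * F n‖ ≤
      N * ((1 + Real.log W) * ((1 + (c₁ * c₂ + c₁ / c₃)) / √k)) +
      #{n ∈ Icc 1 N | ∀ p ∈ {p ∈ Ioc z ⌊W⌋₊ | p.Prime}, ¬ p ∣ n} + N * (2 * k / z) := by
  set P := {p ∈ Ioc z ⌊W⌋₊ | p.Prime} with hPdef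
  have hmem : ∀ p ∈ P, z < p ∧ p ≤ ⌊W⌋₊ ∧ p.Prime := by
    intro p hp
    rw [hPdef, mem_filter, mem_Ioc] at hp
    exact ⟨hp.1.1, hp.1.2, hp.2⟩
  have hPk : ∀ p ∈ P, k ≤ p := fun p hp => by
    have := (hmem p hp).1
    omega
  have h1 := norm_sum_le_sum_blocks hν hν1 hF1 (fun p hp => (hmem p hp).2.2) hk hPk N
  have h2 : ∑ p ∈ P, ∑ q ∈ P with q / k = p / k, (N : ℝ) / (p * q : ℕ) ≤ N * (2 * k / z) := by
    have h3 := sum_same_block_le (P := P) (w := ⌊W⌋₊) hk hz (filter_subset _ _)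
    calc _ = N * ∑ p ∈ P, ∑ q ∈ P with q / k = p / k, (1 : ℝ) / (p * q : ℕ) := by
          simp only [mul_sum, mul_one_div]
      _ ≤ _ := by gcongr
  have hD0 : 0 ≤ (1 + (c₁ * c₂ + c₁ / c₃)) / √k := by positivity
  have h4 : ∑ i ∈ P.image (· / k), ‖∑ m ∈ Icc 1 (N / (i * k)),
        (if ∀ q ∈ P, q / k ≤ i → ¬ q ∣ m then ν m else 0) *
          ∑ p ∈ {p ∈ P | p / k = i} with m * p ≤ N, ν p * F (m * p)‖ ≤
      N * ((1 + Real.log W) * ((1 + (c₁ * c₂ + c₁ / c₃)) / √k)) := by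
    refine (sum_le_sum (g := fun i : ℕ => (N : ℝ) / i * ((1 + (c₁ * c₂ + c₁ / c₃)) / √k))
      fun i hi => norm_block_le hc₁ hc₂ hc₃ hρ ht hF hF1 hcorr
        (fun p hp => (hmem p hp).2.2) hk hPk
        (fun p hp => (Nat.le_floor_iff (by linarith)).1 (hmem p hp).2.1)
        hkW hW hWρ hN hν1 (fun n hn => ?_) hi).trans ?_
    · split_ifs
      · exact hν1 n hn
      · simp
    rw [← sum_mul, ← mul_assoc]
    refine mul_le_mul_of_nonneg_right ?_ hD0
    have hsub : P.image (· / k) ⊆ Icc 1 ⌊W⌋₊ := by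
      rw [image_subset_iff]
      intro p hp
      rw [mem_Icc]
      exact ⟨Nat.div_pos (hPk p hp) hk, (Nat.div_le_self p k).trans (hmem p hp).2.1⟩
    calc ∑ i ∈ P.image (· / k), (N : ℝ) / i ≤ ∑ i ∈ Icc 1 ⌊W⌋₊, (N : ℝ) / i :=
          sum_le_sum_of_subset_of_nonneg hsub fun _ _ _ => by positivity
      _ = N * (harmonic ⌊W⌋₊ : ℝ) := by
          rw [harmonic_eq_sum_Icc]
          push_cast
          simp only [mul_sum, div_eq_mul_inv]
      _ ≤ _ := by
          gcongr
          exact harmonic_floor_le_one_add_log W hW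
  linarith

/-! ### Choice of parameters and conclusion -/

/-- The witnesses are `k = ⌈α⁻⁶⌉` and `J = ⌈20 L⌉`. As `20 log 2 > 8`, the sieve level `2 ^ (J + 1)`
exceeds `α⁻⁸`, while `α ≤ 1/10` gives `2 * k ≤ α⁻⁷`. -/
theorem exists_sieve_parameters {α : ℝ} (hα : 0 < α) (hα10 : α ≤ 1 / 10) :
    ∃ k J : ℕ, 0 < k ∧ 1 ≤ J ∧ 2 * k ≤ 2 ^ (J + 1) ∧
      (k : ℝ) ≤ Real.exp (α⁻¹ * Real.log (1 / α) ^ 6) ∧ 1 / √(k : ℝ) ≤ α ^ 3 ∧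
      (J : ℝ) ≤ 21 * Real.log (1 / α) ∧ 2 * (k : ℝ) / (2 ^ (J + 1) : ℕ) ≤ α := by
  set L := Real.log (1 / α) with hL
  have hinv : (10 : ℝ) ≤ α⁻¹ := by
    rw [le_inv_comm₀ (by norm_num) hα]
    linarith
  have hexpL : Real.exp L = α⁻¹ := by rw [hL, Real.exp_log (by positivity), one_div]
  have hL1 : 1 ≤ L := by
    rw [hL, Real.le_log_iff_exp_le (by positivity), one_div]
    linarith [Real.exp_one_lt_d9]
  have hpow : ∀ n : ℕ, α⁻¹ ^ n = Real.exp (n * L) := fun n => by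
    rw [Real.exp_nat_mul, hexpL]
  have hpow1 : (1 : ℝ) ≤ α⁻¹ ^ 6 := one_le_pow₀ (by linarith)
  have hk2 : (⌈α⁻¹ ^ 6⌉₊ : ℝ) ≤ 2 * α⁻¹ ^ 6 := by
    have := (Nat.ceil_lt_add_one (a := α⁻¹ ^ 6) (by positivity)).le
    linarith
  have hk7 : 2 * (⌈α⁻¹ ^ 6⌉₊ : ℝ) ≤ α⁻¹ ^ 7 := by
    rw [pow_succ (n := 6)]
    nlinarith
  have hJ20 : 20 * L ≤ ⌈20 * L⌉₊ := Nat.le_ceil _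
  have hz8 : α⁻¹ ^ 8 ≤ ((2 ^ (⌈20 * L⌉₊ + 1) : ℕ) : ℝ) := by
    push_cast
    calc α⁻¹ ^ 8 = Real.exp (8 * L) := hpow 8
      _ ≤ Real.exp (⌈20 * L⌉₊ * Real.log 2) := by
          apply Real.exp_le_exp.2
          nlinarith [Real.log_two_gt_d9]
      _ = 2 ^ ⌈20 * L⌉₊ := by rw [Real.exp_nat_mul, Real.exp_log (by norm_num)]
      _ ≤ 2 ^ (⌈20 * L⌉₊ + 1) := pow_le_pow_right₀ (by norm_num) (by omega)
  have h78 : α⁻¹ ^ 7 ≤ α⁻¹ ^ 8 := pow_le_pow_right₀ (by linarith) (by norm_num)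
  refine ⟨⌈α⁻¹ ^ 6⌉₊, ⌈20 * L⌉₊, Nat.ceil_pos.2 (by positivity), Nat.ceil_pos.2 (by positivity),
    ?_, ?_, ?_, ?_, ?_⟩
  · have : 2 * (⌈α⁻¹ ^ 6⌉₊ : ℝ) ≤ ((2 ^ (⌈20 * L⌉₊ + 1) : ℕ) : ℝ) := by linarith
    exact_mod_cast this
  · have h1 : (⌈α⁻¹ ^ 6⌉₊ : ℝ) ≤ α⁻¹ ^ 7 := by
      have : (0 : ℝ) ≤ (⌈α⁻¹ ^ 6⌉₊ : ℝ) := by positivity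
      linarith
    refine h1.trans ?_
    rw [hpow 7]
    apply Real.exp_le_exp.2
    have hL6 : L ≤ L ^ 6 := le_self_pow₀ hL1 (by norm_num)
    push_cast
    nlinarith
  · have h1 : α⁻¹ ^ 3 ≤ √(⌈α⁻¹ ^ 6⌉₊ : ℝ) := by
      apply Real.le_sqrt_of_sq_le
      rw [← pow_mul]
      exact Nat.le_ceil _
    rw [one_div]
    refine (inv_anti₀ (by positivity) h1).trans (le_of_eq ?_)
    rw [inv_pow, inv_inv]
  · have := (Nat.ceil_lt_add_one (a := 20 * L) (by positivity)).le
    linarith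
  · rw [div_le_iff₀ (by positivity)]
    calc 2 * (⌈α⁻¹ ^ 6⌉₊ : ℝ) ≤ α⁻¹ ^ 7 := hk7
      _ = α * α⁻¹ ^ 8 := by field_simp
      _ ≤ _ := by gcongr

theorem lemma6p1 (c₁ c₂ c₃ : ℝ) (hc₁ : 0 < c₁) (hc₂ : 0 < c₂) (hc₃ : 0 < c₃) :
    ∃ C : ℝ, 0 < C ∧
      ∀ (ν : ArithmeticFunction ℂ) (F : ℕ → ℂ) (t : ℕ) (ρ : ℝ),
        ν.IsMultiplicative →
        0 < t →
        Function.Periodic F t →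
        (∀ n : ℕ, 0 < n → ‖ν n‖ ≤ 1) →
        (∀ n : ℕ, 0 < n → ‖F n‖ ≤ 1) →
        ρ < 1 →
        (∀ r s h : ℕ, r.Prime → s.Prime → r ≠ s → 0 < h → h ≤ t →
          ‖∑ n ∈ Finset.Icc 1 h, F (n * r) * (starRingEnd ℂ) (F (n * s))‖
            ≤ c₁ * ((max r s : ℕ) : ℝ) * (t : ℝ) * ρ) →
        ∀ (α : ℝ) (N : ℕ),
          0 < α →
          (α ^ 2)⁻¹ * Real.exp (2 * α⁻¹ * Real.log (1 / α) ^ 6) ≤ c₂ * ρ⁻¹ →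
          c₃ * max 1 ((t : ℝ) * ρ) * Real.exp (4 * α⁻¹ * Real.log (1 / α) ^ 6) ≤ (N : ℝ) →
          ‖∑ n ∈ Finset.Icc 1 N, ν n * F n‖ ≤ C * α * (N : ℝ) := by
  set C₁ := c₁ * c₂ + c₁ / c₃ with hC₁
  set K := (Real.log 4 + 4) * (Real.exp 5 * 21 ^ 4 * 3) with hK
  have hl4 : 0 < Real.log 4 := Real.log_pos (by norm_num)
  have hC₁0 : 0 < C₁ := by positivity
  have hK0 : 0 < K := by positivity
  refine ⟨10 + c₃⁻¹ + 721 * (1 + C₁) + (1 + K) + 1, by positivity, ?_⟩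
  intro ν F t ρ hν ht hF hν1 hF1 _ hcorr α N hα hρα hN
  have hN0 : (0 : ℝ) ≤ N := Nat.cast_nonneg N
  -- Otherwise the trivial bound `N` suffices; the summands `10` and `c₃⁻¹` of the constant serve
  -- this case.
  by_cases hsmall : α ≤ 1 / 10 ∧ α ≤ c₃
  swap
  · have htriv : ‖∑ n ∈ Finset.Icc 1 N, ν n * F n‖ ≤ N := by
      refine (norm_sum_le_of_le (n := fun _ => (1 : ℝ)) _ fun n hn => ?_).trans
        (le_of_eq (by simp))
      have hn0 := (Finset.mem_Icc.1 hn).1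
      rw [norm_mul]
      exact mul_le_one₀ (hν1 n hn0) (norm_nonneg _) (hF1 n hn0)
    refine htriv.trans (le_mul_of_one_le_left hN0 ?_)
    have hrest : 0 ≤ (721 * (1 + C₁) + (1 + K) + 1) * α := by positivity
    have h2 : 0 < c₃⁻¹ * α := by positivity
    rw [not_and_or, not_le, not_le] at hsmall
    rcases hsmall with h | h
    · nlinarith
    · have h3 : 1 ≤ c₃⁻¹ * α := by
        rw [inv_mul_eq_div, one_le_div hc₃]
        exact h.le
      nlinarith
  obtain ⟨hα10, hαc⟩ := hsmall
  set L := Real.log (1 / α) with hL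
  set u := α⁻¹ * L ^ 6 with hu
  have hinv : (10 : ℝ) ≤ α⁻¹ := by
    rw [le_inv_comm₀ (by norm_num) hα]
    linarith
  have hexpL : Real.exp L = α⁻¹ := by rw [hL, Real.exp_log (by positivity), one_div]
  have hL1 : 1 ≤ L := by
    rw [hL, Real.le_log_iff_exp_le (by positivity), one_div]
    linarith [Real.exp_one_lt_d9]
  have hL6 : (1 : ℝ) ≤ L ^ 6 := one_le_pow₀ hL1
  -- One term of the exponential series: `L ^ 6 / 6! ≤ exp L = α⁻¹`.
  have hL6' : α * L ^ 6 ≤ 720 := by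
    have h := Real.pow_div_factorial_le_exp (x := L) (by linarith) 6
    rw [hexpL, show ((Nat.factorial 6 : ℕ) : ℝ) = 720 by norm_num [Nat.factorial],
      div_le_iff₀ (by norm_num)] at h
    calc α * L ^ 6 ≤ α * (α⁻¹ * 720) := by gcongr
      _ = 720 := by field_simp
  have huinv : α⁻¹ ≤ u := le_mul_of_one_le_right (by positivity) hL6
  have hLu : L ≤ u := by
    have : L ≤ α⁻¹ := by rw [← hexpL]; linarith [Real.add_one_le_exp L]
    linarith
  set W := Real.exp u with hW
  have hW1 : 1 ≤ W := Real.one_le_exp (by linarith)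
  have hW0 : 0 < W := by positivity
  have hlogW : Real.log W = u := Real.log_exp u
  have hW2 : Real.exp (2 * α⁻¹ * L ^ 6) = W ^ 2 := by
    rw [hW, ← Real.exp_nat_mul, hu]
    congr 1
    push_cast
    ring
  have hW4 : Real.exp (4 * α⁻¹ * L ^ 6) = W ^ 4 := by
    rw [hW, ← Real.exp_nat_mul, hu]
    congr 1
    push_cast
    ring
  rw [hW2] at hρα
  rw [hW4] at hN
  have hρ : 0 < ρ := by
    have h1 : 0 < c₂ * ρ⁻¹ := lt_of_lt_of_le (by positivity) hρα
    exact inv_pos.1 (pos_of_mul_pos_right h1 hc₂.le)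
  have hWρ : W ^ 2 * ρ ≤ c₂ := by
    have h1 : W ^ 2 ≤ (α ^ 2)⁻¹ * W ^ 2 := by
      refine le_mul_of_one_le_left (by positivity) ?_
      rw [← inv_pow]
      exact one_le_pow₀ (by linarith)
    calc W ^ 2 * ρ ≤ c₂ * ρ⁻¹ * ρ := by
          gcongr
          exact h1.trans hρα
      _ = c₂ := by field_simp
  have hNt : c₃ * (t * ρ) * W ^ 4 ≤ N := by
    refine le_trans ?_ hN
    gcongr
    exact le_max_right _ _
  have hWN : W ^ 3 ≤ N := by
    -- One factor `W ≥ α⁻¹` is spent to absorb `c₃ ≥ α`.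
    have h1 : 1 ≤ c₃ * W := by
      calc 1 = α * α⁻¹ := by field_simp
        _ ≤ c₃ * W := by
          rw [← hexpL]
          gcongr
          exact Real.exp_le_exp.2 hLu
    calc W ^ 3 ≤ (c₃ * W) * W ^ 3 := le_mul_of_one_le_left (by positivity) h1
      _ = c₃ * 1 * W ^ 4 := by ring
      _ ≤ c₃ * max 1 ((t : ℝ) * ρ) * W ^ 4 := by
          gcongr
          exact le_max_left _ _
      _ ≤ N := hN
  have hWN1 : W ≤ N := (le_self_pow₀ hW1 (by norm_num)).trans hWN
  have hlogN : u ≤ Real.log N := by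
    rw [← hlogW]
    exact Real.log_le_log hW0 hWN1
  obtain ⟨k, J, hk, hJ, hz, hkW, hksqrt, hJL, hkz⟩ := exists_sieve_parameters hα hα10
  have hmain := norm_sum_mul_le hc₁ hc₂ hc₃ hρ hν ht hF hν1 hF1 hcorr hk hz hkW hW1 hWρ hNt
  have hw1 : 1 ≤ ⌊W⌋₊ := Nat.le_floor (by exact_mod_cast hW1)
  have hwN : ⌊W⌋₊ ≤ N := Nat.floor_le_of_le hWN1
  have hsieve := card_sifted_mul_log_le hJ hw1 hwN
  classical
  set Q : ℝ := (Finset.card {n ∈ Finset.Icc 1 N |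
    ∀ p ∈ {p ∈ Finset.Ioc (2 ^ (J + 1) : ℕ) ⌊W⌋₊ | p.Prime}, ¬ p ∣ n} : ℝ) with hQ
  have hlogN0 : 0 < Real.log N := by linarith
  have hH : u ≤ (harmonic ⌊W⌋₊ : ℝ) := by
    rw [← hlogW]
    exact log_le_harmonic_floor W hW0.le
  have hu0 : 0 < u := by linarith
  have hQle : Q ≤ N * ((1 + K) * α) := by
    have h1 : Real.exp 5 * (J : ℝ) ^ 4 * (1 + 2 * Real.log N) / harmonic ⌊W⌋₊ ≤
        Real.exp 5 * 21 ^ 4 * 3 * α * Real.log N := by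
      have h2 : 1 + 2 * Real.log N ≤ 3 * Real.log N := by linarith
      calc Real.exp 5 * (J : ℝ) ^ 4 * (1 + 2 * Real.log N) / harmonic ⌊W⌋₊
          ≤ Real.exp 5 * (21 * L) ^ 4 * (3 * Real.log N) / u := by gcongr
        -- Here `L ^ 4` from the Euler product meets `u = α⁻¹ * L ^ 6`, leaving `α` and a spare `L ^
        -- (-2)`.
        _ = Real.exp 5 * 21 ^ 4 * 3 * α * Real.log N * (L ^ 2)⁻¹ := by
          rw [hu]
          field_simp
        _ ≤ _ := by
          refine mul_le_of_le_one_right (by positivity) (inv_le_one_of_one_le₀ (one_le_pow₀ hL1))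
    have h3 : (N : ℝ) ≤ N * (α * Real.log N) := by
      refine le_mul_of_one_le_right hN0 ?_
      calc 1 = α * α⁻¹ := by field_simp
        _ ≤ α * Real.log N := by gcongr; linarith
    have h4 : Q * Real.log N ≤ N * ((1 + K) * α) * Real.log N := by
      refine hsieve.trans ?_
      calc _ ≤ N * (α * Real.log N) +
            (Real.log 4 + 4) * N * (Real.exp 5 * 21 ^ 4 * 3 * α * Real.log N) := by gcongr
        _ = _ := by rw [hK]; ring
    exact le_of_mul_le_mul_right h4 hlogN0
  have hfirst : (1 + Real.log W) * ((1 + C₁) / √(k : ℝ)) ≤ 721 * (1 + C₁) * α := by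
    rw [hlogW]
    calc (1 + u) * ((1 + C₁) / √(k : ℝ)) = (1 + u) * (1 + C₁) * (1 / √(k : ℝ)) := by ring
      _ ≤ (1 + u) * (1 + C₁) * α ^ 3 := by gcongr
      _ = (1 + C₁) * α * (α ^ 2 + α * L ^ 6) := by
        rw [hu]
        field_simp
      _ ≤ (1 + C₁) * α * (1 + 720) := by
        gcongr
        exact pow_le_one₀ hα.le (by linarith)
      _ = _ := by ring
  calc _ ≤ N * ((1 + Real.log W) * ((1 + C₁) / √(k : ℝ))) + Q +
        N * (2 * k / (2 ^ (J + 1) : ℕ)) := hmain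
    _ ≤ N * (721 * (1 + C₁) * α) + N * ((1 + K) * α) + N * α := by gcongr
    _ ≤ _ := by
      have : 0 ≤ (10 + c₃⁻¹) * α * N := by positivity
      linarith
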